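/- Let $I$ be a set of cardinality $\omega_1$ (that is, $\aleph_1$), let $p\in\mathbb R^{I}$, and let $X=\{x\in\mathbb R^{I} : \{i\in I : x_i\neq p_i\}\text{ is countable}\}$, with the subspace topology inherited from the Tychonoff product $\mathbb R^{I}$, be the $\Sigma$-product of $\omega_1$ copies of $\mathbb R$ with base point $p$ (for instance $p=0$). Let $AD(X)$ be the Alexandroff duplicate of $X$, that is, the set $X\times\{0,1\}$ with the topology in which every point $(x,1)$ is isolated and the basic neighbourhoods of a point $(x,0)$ are the sets $(U\times\{0,1\})\setminus\{(x,1)\}$, where $U$ is a neighbourhood of $x$ in $X$. Let $C_p(AD(X))$ be the set of all continuous functions $AD(X)\to\mathbb R$ with the topology of pointwise convergence. Then $C_p(AD(X))$ is Lindelöf, that is, every open cover of it has a countable subcover. -/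

import Mathlib

open Set Topology

/-- The `Σ`-product of `ι` many copies of the real line with base point `p`: the subspace of the
Tychonoff product `ι → ℝ` of all points that differ from `p` in at most countably many
coordinates. -/
abbrev SigmaProduct {ι : Type*} (p : ι → ℝ) : Type _ :=
  {x : ι → ℝ // {i | x i ≠ p i}.Countable}

/-- The underlying set `X × {0, 1}` of the Alexandroff duplicate of `X`
(as a definition of its own, so that it does not carry the product topology). -/
def AlexandroffDuplicate (X : Type*) : Type _ := X × Fin 2

namespace AlexandroffDuplicate

variable {X : Type*}

/-- The point `(x, i)` of the Alexandroff duplicate. -/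
def mk (x : X) (i : Fin 2) : AlexandroffDuplicate X := (x, i)

/-- The projection of the Alexandroff duplicate onto `X`. -/
def proj (z : AlexandroffDuplicate X) : X := z.1

/-- The basic neighbourhood `(U × {0, 1}) \ {(x, 1)}` of the point `(x, 0)`. -/
def basicNhd (x : X) (U : Set X) : Set (AlexandroffDuplicate X) :=
  {z | proj z ∈ U} \ {mk x 1}

/-- The topology of the Alexandroff duplicate: a set is open iff with each of its points `(x, 0)`
it contains `(U × {0, 1}) \ {(x, 1)}` for some neighbourhood `U` of `x`
(no condition at the points `(x, 1)`, which are isolated). For a `T₁` space `X` these sets are then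
a neighbourhood base at `(x, 0)`. -/
instance [TopologicalSpace X] : TopologicalSpace (AlexandroffDuplicate X) where
  IsOpen W := ∀ x : X, mk x 0 ∈ W → ∃ U ∈ 𝓝 x, basicNhd x U ⊆ W
  isOpen_univ := fun _ _ => ⟨univ, Filter.univ_mem, subset_univ _⟩
  isOpen_inter := by
    intro V W hV hW x hx
    obtain ⟨A, hA, hAV⟩ := hV x hx.1
    obtain ⟨B, hB, hBW⟩ := hW x hx.2
    exact ⟨A ∩ B, Filter.inter_mem hA hB, fun z hz =>
      ⟨hAV ⟨hz.1.1, hz.2⟩, hBW ⟨hz.1.2, hz.2⟩⟩⟩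
  isOpen_sUnion := by
    intro S hS x hx
    obtain ⟨W, hWS, hxW⟩ := hx
    obtain ⟨U, hU, hUW⟩ := hS W hWS x hxW
    exact ⟨U, hU, hUW.trans (subset_sUnion_of_mem hWS)⟩

end AlexandroffDuplicate

/-- The space `C_p(Y)` of all continuous real-valued functions on `Y` with the topology of
pointwise convergence, that is, as a subspace of the Tychonoff product `Y → ℝ`. -/
abbrev Cp (Y : Type*) [TopologicalSpace Y] : Type _ := {f : Y → ℝ // Continuous f}

/-!
The Alexandroff duplicate of a `Σ`-product `X` is itself, up to homeomorphism, a subspace of a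
`Σ`-product of lines: send `(x, e)` to the coordinates of `x` together with the indicators of the
isolated points `(s, 1)`, `s ∈ X`, evaluated at `(x, e)`
(`AlexandroffDuplicate.isInducing_coord`). Replacing all coordinates outside a set
`A ⊆ ι ⊕ X` by those of the base point `(p, 0)` maps this subspace to itself as soon as `A`
contains, with each point `s ∈ X`, the coordinates in which `s` differs from `p`
(`AlexandroffDuplicate.exists_coord_eq_ite`).

For every subspace `T` of a `Σ`-product with such a supply of retractions, `C_p(T)` is Lindelöf
(`lindelofSpace_Cp_of_isInducing`). Given an open cover, let `F_O ⊆ Tⁿ`, for each tuple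
`O = (O₁, …, Oₙ)` of basic open subsets of the line, be the set of tuples `y` for which
`{f | f(yᵢ) ∈ Oᵢ for all i}` lies in a member of the cover. There are countably many `O`, so a
closing-off argument (`exists_countable_retraction_approx`) gives a countable `A` with retraction
`r` of `T` and countable sets `C_O ⊆ F_O` with `r(F_O)` in the closure of `C_O`. For a continuous
function `f`, the function `f ∘ r` lies in `{g | g(yᵢ) ∈ Oᵢ}` for some `O` and some `y ∈ F_O`;
hence `f(r(yᵢ)) ∈ Oᵢ`, and by continuity `f(cᵢ) ∈ Oᵢ` for some `c ∈ C_O`. So the countably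
many members of the cover chosen for the elements of the sets `C_O` already cover `C_p(T)`.
-/

/-! ### Closing off countable sets of coordinates -/

theorem exists_monotone_countable_seq {κ : Type*} (H : Set κ → Set κ)
    (hH : ∀ A, A.Countable → (H A).Countable) :
    ∃ A : ℕ → Set κ, Monotone A ∧ (∀ m, (A m).Countable) ∧ ∀ m, H (A m) ⊆ A (m + 1) := by
  let A : ℕ → Set κ := fun m => Nat.rec ∅ (fun _ B => B ∪ H B) m
  have hs : ∀ m, A (m + 1) = A m ∪ H (A m) := fun _ => rfl
  refine ⟨A, monotone_nat_of_le_succ fun m => ?_, fun m => ?_, fun m => ?_⟩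
  · rw [hs]; exact subset_union_left
  · induction m with
    | zero => exact countable_empty
    | succ m ih => rw [hs]; exact ih.union (hH _ ih)
  · rw [hs]; exact subset_union_right

/-- Seen through countably many coordinates, every set of tuples has a countable dense subset. -/
theorem exists_countable_subset_approx {T κ : Type*} (φ : T → κ → ℝ) {A : Set κ}
    (hA : A.Countable) {n : ℕ} (F : Set (Fin n → T)) :
    ∃ C ⊆ F, C.Countable ∧ ∀ y ∈ F, ∀ (B : Fin n → Finset κ) (v : Fin n → κ → Set ℝ),
      (∀ i, ∀ b ∈ B i, IsOpen (v i b)) → (∀ i, ∀ b ∈ B i, b ∈ A → φ (y i) b ∈ v i b) →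
      ∃ c ∈ C, ∀ i, ∀ b ∈ B i, b ∈ A → φ (c i) b ∈ v i b := by
  have : Countable A := hA.to_subtype
  let Φ : F → Fin n → A → ℝ := fun y i b => φ (y.1 i) b
  let _ : TopologicalSpace F := TopologicalSpace.induced Φ inferInstance
  have : SecondCountableTopology F := TopologicalSpace.secondCountableTopology_induced _ _ Φ
  obtain ⟨D, hDc, hD⟩ := TopologicalSpace.exists_countable_dense F
  refine ⟨Subtype.val '' D, by rintro _ ⟨y, _, rfl⟩; exact y.2, hDc.image _, ?_⟩
  intro y hy B v hv hyv
  have hΦ : Continuous Φ := continuous_induced_dom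
  have hopen : IsOpen {z : F | ∀ i, ∀ b ∈ B i, ∀ hb : b ∈ A, Φ z i ⟨b, hb⟩ ∈ v i b} := by
    simp only [ofPred_forall]
    refine isOpen_iInter_of_finite fun i => isOpen_biInter_finset fun b hb =>
      isOpen_iInter_of_finite fun hbA => (hv i b hb).preimage ?_
    exact (continuous_apply (⟨b, hbA⟩ : A)).comp
      ((continuous_apply (A := fun _ => A → ℝ) i).comp hΦ)
  obtain ⟨c, hcD, hc⟩ := hD.exists_mem_open hopen ⟨⟨y, hy⟩, hyv⟩
  exact ⟨c, ⟨c, hcD, rfl⟩, hc⟩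

/-- The closing-off argument: for countably many sets `F k` of tuples there are a countable set
`A` of coordinates, closed under `g`, and countable sets `C k ⊆ F k` such that each tuple in `F k`,
once its coordinates outside `A` are replaced by those of `q`, lies in the closure of `C k`. -/
theorem exists_countable_retraction_approx {T κ K : Type*} [Countable K] (φ : T → κ → ℝ)
    (q : κ → ℝ) (hφ : ∀ t, {a | φ t a ≠ q a}.Countable)
    (g : κ → Set κ) (hg : ∀ a, (g a).Countable) (n : K → ℕ) (F : ∀ k, Set (Fin (n k) → T)) :
    ∃ A : Set κ, A.Countable ∧ (∀ a ∈ A, g a ⊆ A) ∧ ∃ C : ∀ k, Set (Fin (n k) → T),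
      (∀ k, C k ⊆ F k) ∧ (∀ k, (C k).Countable) ∧
      ∀ k, ∀ y ∈ F k, ∀ (B : Fin (n k) → Finset κ) (v : Fin (n k) → κ → Set ℝ),
        (∀ i, ∀ b ∈ B i, IsOpen (v i b)) →
        (∀ i, ∀ b ∈ B i, b ∈ A → φ (y i) b ∈ v i b) →
        (∀ i, ∀ b ∈ B i, b ∉ A → q b ∈ v i b) →
        ∃ c ∈ C k, ∀ i, ∀ b ∈ B i, φ (c i) b ∈ v i b := by
  choose! C hCF hCc hC using fun (A : Set κ) (hA : A.Countable) (k : K) =>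
    exists_countable_subset_approx φ hA (F k)
  obtain ⟨A, hmono, hAc, hH⟩ := exists_monotone_countable_seq
    (fun A => (⋃ a ∈ A, g a) ∪ ⋃ k, ⋃ c ∈ C A k, ⋃ i, {a | φ (c i) a ≠ q a}) (fun A hA => by
      refine (hA.biUnion fun a _ => hg a).union ?_
      exact countable_iUnion fun k => (hCc A hA k).biUnion fun c _ =>
        countable_iUnion fun i => hφ _)
  refine ⟨⋃ m, A m, countable_iUnion hAc, ?_, fun k => ⋃ m, C (A m) k,
    fun k => iUnion_subset fun m => hCF _ (hAc m) k,
    fun k => countable_iUnion fun m => hCc _ (hAc m) k, ?_⟩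
  · intro a ha b hb
    obtain ⟨m, hm⟩ := mem_iUnion.1 ha
    exact mem_iUnion.2 ⟨m + 1, hH m (Or.inl (mem_biUnion hm hb))⟩
  · intro k y hy B v hv hyv hqv
    -- One stage `m` captures the finitely many coordinates in question that belong to `⋃ m, A m`.
    obtain ⟨m, hm⟩ : ∃ m, ∀ i, ∀ b ∈ B i, b ∈ ⋃ m, A m → b ∈ A m := by
      have hfin : ((⋃ i, (B i : Set κ)) ∩ ⋃ m, A m).Finite :=
        (finite_iUnion fun i => (B i).finite_toSet).inter_of_left _
      obtain ⟨m, hm⟩ := (hmono.directed_le).exists_mem_subset_of_finset_subset_biUnion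
        (s := hfin.toFinset) (by simp)
      refine ⟨m, fun i b hb hbA => hm ?_⟩
      simp only [Finite.coe_toFinset]
      exact ⟨mem_iUnion.2 ⟨i, hb⟩, hbA⟩
    obtain ⟨c, hc, hcv⟩ := hC (A m) (hAc m) k y hy B v hv
      fun i b hb hbA => hyv i b hb (mem_iUnion.2 ⟨m, hbA⟩)
    refine ⟨c, mem_iUnion.2 ⟨m, hc⟩, fun i b hb => ?_⟩
    by_cases hbA : b ∈ ⋃ m, A m
    · exact hcv i b hb (hm i b hb hbA)
    · -- The coordinates in which `c i` differs from `q` were added at stage `m + 1`.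
      have : φ (c i) b = q b := by
        by_contra hne
        refine hbA (mem_iUnion.2 ⟨m + 1, hH m (Or.inr ?_)⟩)
        exact mem_iUnion.2 ⟨k, mem_biUnion hc (mem_iUnion.2 ⟨i, hne⟩)⟩
      rw [this]
      exact hqv i b hb hbA

/-! ### Function spaces over retractive subspaces of `Σ`-products -/

open Classical in
/-- Let `T` carry the topology induced by a map into a `Σ`-product with base point `q` such that,
for every countable set `A` of coordinates closed under `g`, the image of `T` is mapped to itself
when the coordinates outside `A` are replaced by those of `q`. Then `C_p(T)` is Lindelöf. -/
theorem lindelofSpace_Cp_of_isInducing {T κ : Type*} [TopologicalSpace T] {φ : T → κ → ℝ}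
    (hind : IsInducing φ) (q : κ → ℝ) (hφ : ∀ t, {a | φ t a ≠ q a}.Countable)
    (g : κ → Set κ) (hg : ∀ a, (g a).Countable)
    (hr : ∀ A : Set κ, A.Countable → (∀ a ∈ A, g a ⊆ A) →
      ∀ t, ∃ t', ∀ a, φ t' a = if a ∈ A then φ t a else q a) :
    LindelofSpace (Cp T) := by
  refine ⟨isLindelof_of_countable_subcover fun {J} U hU hcov => ?_⟩
  let 𝓑 := TopologicalSpace.countableBasis ℝ
  have : Countable 𝓑 := (TopologicalSpace.countable_countableBasis ℝ).to_subtype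
  obtain ⟨A, hAc, hAg, C, hCF, hCc, hC⟩ := exists_countable_retraction_approx
    (K := Σ n : ℕ, Fin n → 𝓑) φ q hφ g hg (fun k => k.1)
    (fun k => {y | ∃ j, ∀ f : Cp T, (∀ i, f.1 (y i) ∈ (k.2 i).1) → f ∈ U j})
  have hJ : Nonempty J := by
    obtain ⟨j, -⟩ := mem_iUnion.1 (hcov (mem_univ ⟨0, continuous_const⟩))
    exact ⟨j⟩
  choose! j hj using hCF
  refine ⟨⋃ k, j k '' C k, countable_iUnion fun k => (hCc k).image _, fun f _ => ?_⟩
  choose r hr using hr A hAc hAg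
  have hrc : Continuous r := by
    rw [hind.continuous_iff, continuous_pi_iff]
    intro a
    simp only [Function.comp_def, hr]
    split_ifs
    · exact (continuous_apply a).comp hind.continuous
    · exact continuous_const
  -- A basic neighbourhood of `f ∘ r` inside a member of the cover.
  obtain ⟨j₀, hj₀⟩ := mem_iUnion.1 (hcov (mem_univ (⟨f.1 ∘ r, f.2.comp hrc⟩ : Cp T)))
  obtain ⟨W, hW, hWU⟩ := isOpen_induced_iff.1 (hU j₀)
  rw [← hWU] at hj₀
  obtain ⟨I, u, hu, huW⟩ := isOpen_pi_iff.1 hW _ hj₀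
  let y : Fin I.card → T := fun i => (I.equivFin.symm i).1
  have hyI : ∀ i, y i ∈ I := fun i => (I.equivFin.symm i).2
  choose O hO hfO hOu using fun i =>
    (TopologicalSpace.isBasis_countableBasis ℝ).exists_subset_of_mem_open
      (hu (y i) (hyI i)).2 (hu (y i) (hyI i)).1
  let k : Σ n : ℕ, Fin n → 𝓑 := ⟨I.card, fun i => ⟨O i, hO i⟩⟩
  have hyF : ∃ j, ∀ f : Cp T, (∀ i, f.1 (y i) ∈ O i) → f ∈ U j := by
    refine ⟨j₀, fun h hh => ?_⟩
    rw [← hWU]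
    refine huW fun t ht => ?_
    have := hOu (I.equivFin ⟨t, ht⟩) (hh _)
    simpa [y] using this
  -- Basic neighbourhoods of the points `r (y i)` that `f` maps into `O i`.
  have hnhd : ∀ i, ∃ (B : Finset κ) (v : κ → Set ℝ),
      (∀ b ∈ B, IsOpen (v b) ∧ φ (r (y i)) b ∈ v b) ∧
      ∀ t, (∀ b ∈ B, φ t b ∈ v b) → f.1 t ∈ O i := by
    intro i
    obtain ⟨V, hV, hVf⟩ := hind.isOpen_iff.1
      ((TopologicalSpace.isOpen_of_mem_countableBasis (hO i)).preimage f.2)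
    have hmem : φ (r (y i)) ∈ V := by
      change r (y i) ∈ φ ⁻¹' V
      rw [hVf]; exact hfO i
    obtain ⟨B, v, hv, hvV⟩ := isOpen_pi_iff.1 hV _ hmem
    refine ⟨B, v, hv, fun t ht => ?_⟩
    change t ∈ f.1 ⁻¹' O i
    rw [← hVf]
    exact hvV ht
  choose B v hv hvO using hnhd
  obtain ⟨c, hc, hcv⟩ := hC k y hyF B v (fun i b hb => (hv i b hb).1)
    (fun i b hb hbA => by simpa [hr, hbA] using (hv i b hb).2)
    (fun i b hb hbA => by simpa [hr, hbA] using (hv i b hb).2)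
  exact mem_biUnion (mem_iUnion.2 ⟨k, c, hc, rfl⟩)
    (hj k hc f fun i => hvO i (c i) (hcv i))

/-! ### The Alexandroff duplicate of a `Σ`-product as a subspace of a `Σ`-product -/

namespace AlexandroffDuplicate

theorem isOpen_iff {X : Type*} [TopologicalSpace X] {W : Set (AlexandroffDuplicate X)} :
    IsOpen W ↔ ∀ x : X, mk x 0 ∈ W → ∃ U ∈ 𝓝 x, basicNhd x U ⊆ W :=
  Iff.rfl

theorem continuous_proj {X : Type*} [TopologicalSpace X] :
    Continuous (proj : AlexandroffDuplicate X → X) :=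
  ⟨fun O hO => isOpen_iff.2 fun _ hx => ⟨O, hO.mem_nhds hx, fun _ hz => hz.1⟩⟩

theorem isClopen_singleton_mk_one {X : Type*} [TopologicalSpace X] [T1Space X] (s : X) :
    IsClopen ({mk s 1} : Set (AlexandroffDuplicate X)) := by
  constructor
  · refine ⟨isOpen_iff.2 fun x _ => ?_⟩
    by_cases hxs : x = s
    · subst hxs
      exact ⟨univ, Filter.univ_mem, fun _ hz => hz.2⟩
    · refine ⟨{s}ᶜ, isOpen_compl_singleton.mem_nhds hxs, fun z hz hzs => hz.1 ?_⟩
      rw [mem_singleton_iff.1 hzs]; rfl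
  · refine isOpen_iff.2 fun x hx => ?_
    exact absurd (congrArg Prod.snd (mem_singleton_iff.1 hx)) zero_ne_one

variable {ι : Type*} {p : ι → ℝ}

open Classical in
/-- The coordinates of a point `z = (x, e)` of the Alexandroff duplicate of a `Σ`-product: those
of `x`, and for each `s` the value at `z` of the indicator of the isolated point `(s, 1)`. -/
noncomputable def coord (z : AlexandroffDuplicate (SigmaProduct p)) : ι ⊕ SigmaProduct p → ℝ :=
  Sum.elim (proj z).1 fun s => if z = mk s 1 then 1 else 0

theorem eq_mk_zero_or_one (z : AlexandroffDuplicate (SigmaProduct p)) :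
    z = mk (proj z) 0 ∨ z = mk (proj z) 1 := by
  obtain ⟨x, e⟩ := z
  fin_cases e
  · exact Or.inl rfl
  · exact Or.inr rfl

theorem continuous_coord :
    Continuous (coord : AlexandroffDuplicate (SigmaProduct p) → _) := by
  classical
  refine continuous_pi fun a => ?_
  cases a with
  | inl i => exact (continuous_apply i).comp (continuous_subtype_val.comp continuous_proj)
  | inr s =>
    convert (isClopen_singleton_mk_one s).continuous_indicator
      (continuous_const (y := (1 : ℝ))) using 2 with z
    simp [coord, indicator_apply]

/-- The coordinates of `x` and the indicators of the isolated points determine the topology: the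
set `(U × {0, 1}) \ {(x, 1)}` is given by `U` and by the indicator of `(x, 1)` being less than `1`,
and `{(x, 1)}` by this indicator being positive. -/
theorem isInducing_coord :
    IsInducing (coord : AlexandroffDuplicate (SigmaProduct p) → _) := by
  refine isInducing_iff_nhds.2 fun z => le_antisymm continuous_coord.continuousAt.le_comap ?_
  intro W hW
  obtain ⟨W', hW'W, hW'o, hzW'⟩ := mem_nhds_iff.1 hW
  rw [Filter.mem_comap]
  have hind : ∀ s (P : Set ℝ), IsOpen P → coord z (Sum.inr s) ∈ P →
      {w : ι ⊕ SigmaProduct p → ℝ | w (Sum.inr s) ∈ P} ∈ 𝓝 (coord z) := fun s P hP hz =>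
    (hP.preimage (continuous_apply (Sum.inr s))).mem_nhds hz
  rcases eq_mk_zero_or_one z with h | h
  · obtain ⟨U, hU, hUW⟩ := isOpen_iff.1 hW'o (proj z) (h ▸ hzW')
    obtain ⟨V, hV, hVU⟩ := mem_nhds_induced _ _ _ |>.1 hU
    refine ⟨{w | (fun i => w (Sum.inl i)) ∈ V} ∩ {w | w (Sum.inr (proj z)) ∈ Iio (1 : ℝ)},
      Filter.inter_mem ?_ (hind _ _ isOpen_Iio ?_), ?_⟩
    · have : Continuous fun (w : ι ⊕ SigmaProduct p → ℝ) i => w (Sum.inl i) := by fun_prop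
      exact this.continuousAt.preimage_mem_nhds hV
    · have : z ≠ mk (proj z) 1 := fun h' =>
        zero_ne_one (congrArg Prod.snd (h.symm.trans h'))
      simp [coord, this]
    · rintro t ⟨htV, ht1⟩
      refine hW'W (hUW ⟨hVU htV, fun ht => ?_⟩)
      rw [mem_singleton_iff] at ht
      rw [mem_ofPred_eq, coord, Sum.elim_inr, if_pos ht] at ht1
      exact lt_irrefl _ (mem_Iio.1 ht1)
  · refine ⟨{w | w (Sum.inr (proj z)) ∈ Ioi (0 : ℝ)}, hind _ _ isOpen_Ioi ?_, ?_⟩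
    · rw [mem_Ioi, coord, Sum.elim_inr, if_pos h]
      exact one_pos
    · intro t ht
      have : t = mk (proj z) 1 := by
        by_contra hne
        simp [coord, hne] at ht
      rw [this, ← h]
      exact hW'W hzW'

theorem countable_coord_ne (z : AlexandroffDuplicate (SigmaProduct p)) :
    {a | coord z a ≠ Sum.elim p (fun _ => 0) a}.Countable := by
  refine (((proj z).2.image Sum.inl).union (countable_singleton (Sum.inr (proj z)))).mono ?_
  rintro (i | s) ha
  · exact Or.inl ⟨i, ha, rfl⟩
  · refine Or.inr ?_
    have : z = mk s 1 := by
      by_contra hne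
      simp [coord, hne] at ha
    rw [this]; rfl

open Classical in
/-- If `A` contains, with each `s`, the coordinates in which `s` differs from `p`, then replacing
the coordinates outside `A` by those of the base point takes the Alexandroff duplicate to
itself: the point `(x, e)` goes to itself if `e = 1` and `x ∈ A`, and otherwise to `(x', 0)`, with
`x'` the restriction of `x` to `A`. -/
theorem exists_coord_eq_ite {A : Set (ι ⊕ SigmaProduct p)}
    (hA : ∀ s, Sum.inr s ∈ A → ∀ i, s.1 i ≠ p i → Sum.inl i ∈ A)
    (z : AlexandroffDuplicate (SigmaProduct p)) :
    ∃ z' : AlexandroffDuplicate (SigmaProduct p),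
      ∀ a, coord z' a = if a ∈ A then coord z a else Sum.elim p (fun _ => 0) a := by
  by_cases h : z = mk (proj z) 1 ∧ Sum.inr (proj z) ∈ A
  · refine ⟨z, ?_⟩
    rintro (i | s)
    · split_ifs with hi
      · rfl
      · by_contra hne
        exact hi (hA _ h.2 i hne)
    · split_ifs with hs
      · rfl
      · have : z ≠ mk s 1 := by
          rintro rfl
          exact hs h.2
        simp [coord, this]
  · let x' : SigmaProduct p := ⟨fun i => if Sum.inl i ∈ A then (proj z).1 i else p i,
      (proj z).2.mono fun i hi => by
        by_contra hne
        simp only [mem_ofPred_eq, not_not] at hne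
        simp [hne] at hi⟩
    refine ⟨mk x' 0, ?_⟩
    rintro (i | s)
    · rfl
    · have h0 : mk x' 0 ≠ mk s 1 := fun h => zero_ne_one (congrArg Prod.snd h)
      have hz : Sum.inr s ∈ A → z ≠ mk s 1 := by
        rintro hs rfl
        exact h ⟨rfl, hs⟩
      split_ifs with hs
      · simp [coord, h0, hz hs]
      · simp [coord, h0]

end AlexandroffDuplicate

theorem corollary3p6 {ι : Type*} (hι : Cardinal.mk ι = Cardinal.aleph 1) (p : ι → ℝ) :
    LindelofSpace (Cp (AlexandroffDuplicate (SigmaProduct p))) := by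
  refine lindelofSpace_Cp_of_isInducing AlexandroffDuplicate.isInducing_coord
    (Sum.elim p fun _ => 0) AlexandroffDuplicate.countable_coord_ne
    (Sum.elim (fun _ => ∅) fun s => Sum.inl '' {i | s.1 i ≠ p i}) ?_ ?_
  · rintro (i | s)
    · exact countable_empty
    · exact s.2.image _
  · intro A _ hA
    exact AlexandroffDuplicate.exists_coord_eq_ite
      fun s hs i hi => hA _ hs (mem_image_of_mem _ hi)
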